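/- Let $p$ be a prime and let $n,s,m$ be positive integers with $\gcd(n,p)=1$. Put $F=\mathbb{F}_{p^m}$ and $\mathcal{R}=F[u]/\langle u^3\rangle$. Let $\alpha\in F\setminus\{0\}$, let $\alpha_0\in F$ satisfy $\alpha_0^{p^s}=\alpha$, and let $x^n-\alpha_0=f_1(x)\cdots f_r(x)$ with pairwise coprime monic irreducible $f_i(x)\in F[x]$. Fix $j$, write $f=f_j$, $d=\deg f_j$, $q=p^s$, and $\mathcal{K}_j=\mathcal{R}[x]/\langle f(x)^{q}\rangle$ (the $j$th local component of $\mathcal{R}[x]/\langle x^{np^s}-\lambda\rangle$ for $\lambda=\alpha+\beta u+\gamma u^2$ with $\beta=\gamma=0$). Put $\mathcal{S}=F[x]/\langle f(x)^q\rangle$, regarded as a subring of $\mathcal{K}_j$. For an ideal $I$ of $\mathcal{K}_j$ let $\mathrm{Res}_u(I)=\{a_0\in\mathcal S: a_0+ua_1+u^2a_2\in I\text{ for some }a_1,a_2\in\mathcal S\}$, $\mathrm{Tor}_u(I)=\{a_1\in\mathcal S: ua_1+u^2a_2\in I\text{ for some }a_2\in\mathcal S\}$ and $\mathrm{Tor}_{u^2}(I)=\{a_2\in\mathcal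 S: u^2a_2\in I\}$; these are ideals of $\mathcal S$. Say that a polynomial $G\in F[x]$ is *admissible of length $k$* if $G=0$, or $G$ is a unit of $\mathcal{K}_j$ of the form $\sum_{i=0}^{k-1}B_i(x)f(x)^i$ with each $B_i\in F[x]$ zero or of degree less than $d$. A term with a zero factor is read as $0$, whatever the exponents in it. Let $I$ be a non-trivial ideal of $\mathcal{K}_j$ (that is, $I\ne 0$ and $I\neq\mathcal{K}_j$). Then there are integers $0\le c\le b\le a\le q$ with $\mathrm{Res}_u(I)=\langle f^a\rangle$, $\mathrm{Tor}_u(I)=\langle f^b\rangle$, $\mathrm{Tor}_{u^2}(I)=\langle f^c\rangle$, and for any such $a,b,c$ the following hold. **Type I.** If $a=b=q$, then $c<q$, $I=\langle u^2f^c\rangle$, $|I|=p^{md(q-c)}$ and $\mathrm{ann}(I)=\langle f^{q-c},\,u\rangle$. **Type II.** If $a=q$ and $b<q$, then there are an integer $t\ge 0$ and a polynomial $G$, admissible of length $c-t$, with $c+b-q\le t<c$ if $G\ne0$, such that $$I=\langle uf^b+u^2f^tG,\ u^2f^c\rangle .$$ Moreover $|I|=p^{md(2q-b-c)}$, and for every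 such $t,G$, $$\mathrm{ann}(I)=\langle f^{q-c}-uf^{q-c+t-b}G,\ uf^{q-b},\ u^2\rangle .$$ **Type III.** If $a<q$, then there are integers $t_1,t_2,\theta\ge0$ and polynomials $D_1,D_2,V$, admissible of lengths $b-t_1$, $c-t_2$, $c-\theta$ respectively, with $a+b-q\le t_1<b$ if $D_1\ne0$, $t_2<c$ if $D_2\neq0$, and $b+c-q\le\theta<c$ if $V\ne0$, such that $$I=\langle f^a+uf^{t_1}D_1+u^2f^{t_2}D_2,\ uf^b+u^2f^\theta V,\ u^2f^c\rangle .$$ Moreover $|I|=p^{md(3q-a-b-c)}$, and for all such $t_1,t_2,\theta,D_1,D_2,V$ there exists $A\in\mathcal S$ with $$u^2\bigl(f^{q-a+t_1-b+\theta}VD_1-f^{q-a+t_2}D_2\bigr)=u^2f^cA,$$ and for every such $A$, $$\mathrm{ann}(I)=\langle f^{q-c}-uf^{q-c+\theta-b}V+u^2A,\ uf^{q-b}-u^2f^{q-a+t_1-b}D_1,\ u^2f^{q-a}\rangle .$$ -/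

import Mathlib

open scoped Polynomial

namespace Constacyclic

noncomputable section

/-- The chain ring `F[u]/⟨u³⟩`; the class of the variable is `u`. -/
abbrev ChainRing (F : Type*) [Field F] : Type _ :=
  AdjoinRoot ((Polynomial.X : F[X]) ^ 3)

/-- The ring `𝒦 = (F[u]/⟨u³⟩)[x] / ⟨f(x)^q⟩`, with `f ∈ F[x]` viewed in `(F[u]/⟨u³⟩)[x]`. -/
abbrev KRing {F : Type*} [Field F] (f : F[X]) (q : ℕ) : Type _ :=
  AdjoinRoot ((f ^ q).map (AdjoinRoot.of ((Polynomial.X : F[X]) ^ 3)))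

/-- The ring `F[x] / ⟨f(x)^q⟩`. -/
abbrev ResRing {F : Type*} [Field F] (f : F[X]) (q : ℕ) : Type _ :=
  AdjoinRoot (f ^ q)

variable {F : Type*} [Field F] (f : F[X]) (q : ℕ)

/-- The element `u` of `𝒦`. -/
def uElt : KRing f q :=
  AdjoinRoot.of _ (AdjoinRoot.root ((Polynomial.X : F[X]) ^ 3))

/-- A polynomial of `F[x]` viewed as an element of `𝒦`. -/
def ofPoly : F[X] →+* KRing f q :=
  (AdjoinRoot.mk _).comp
    (Polynomial.mapRingHom (AdjoinRoot.of ((Polynomial.X : F[X]) ^ 3)))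

/-- An element of `F[x]/⟨f^q⟩` viewed as an element of `𝒦`. -/
def ofRes : ResRing f q →+* KRing f q :=
  Ideal.Quotient.lift (Ideal.span {f ^ q}) (ofPoly f q) (by
    intro g hg
    obtain ⟨h, rfl⟩ := Ideal.mem_span_singleton'.1 hg
    rw [map_mul]
    have h0 : ofPoly f q (f ^ q) = 0 := AdjoinRoot.mk_self
    rw [h0, mul_zero])

variable {f q}

/-- `Res_u(I) = {a₀ : a₀ + u a₁ + u² a₂ ∈ I for some a₁, a₂}`. -/
def ResU (I : Ideal (KRing f q)) : Ideal (ResRing f q) where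
  carrier := {a₀ | ∃ a₁ a₂ : ResRing f q,
    ofRes f q a₀ + uElt f q * ofRes f q a₁ + uElt f q ^ 2 * ofRes f q a₂ ∈ I}
  zero_mem' := ⟨0, 0, by simp⟩
  add_mem' := by
    rintro a b ⟨a₁, a₂, ha⟩ ⟨b₁, b₂, hb⟩
    refine ⟨a₁ + b₁, a₂ + b₂, ?_⟩
    convert I.add_mem ha hb using 1
    simp only [map_add]
    ring
  smul_mem' := by
    rintro r a ⟨a₁, a₂, ha⟩
    refine ⟨r * a₁, r * a₂, ?_⟩
    convert I.mul_mem_left (ofRes f q r) ha using 1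
    simp only [smul_eq_mul, map_mul]
    ring

/-- `Tor_u(I) = {a₁ : u a₁ + u² a₂ ∈ I for some a₂}`. -/
def TorU (I : Ideal (KRing f q)) : Ideal (ResRing f q) where
  carrier := {a₁ | ∃ a₂ : ResRing f q,
    uElt f q * ofRes f q a₁ + uElt f q ^ 2 * ofRes f q a₂ ∈ I}
  zero_mem' := ⟨0, by simp⟩
  add_mem' := by
    rintro a b ⟨a₂, ha⟩ ⟨b₂, hb⟩
    refine ⟨a₂ + b₂, ?_⟩
    convert I.add_mem ha hb using 1
    simp only [map_add]
    ring
  smul_mem' := by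
    rintro r a ⟨a₂, ha⟩
    refine ⟨r * a₂, ?_⟩
    convert I.mul_mem_left (ofRes f q r) ha using 1
    simp only [smul_eq_mul, map_mul]
    ring

/-- `Tor_{u²}(I) = {a₂ : u² a₂ ∈ I}`. -/
def TorU2 (I : Ideal (KRing f q)) : Ideal (ResRing f q) where
  carrier := {a₂ | uElt f q ^ 2 * ofRes f q a₂ ∈ I}
  zero_mem' := by simp
  add_mem' := by
    intro a b ha hb
    change uElt f q ^ 2 * ofRes f q (a + b) ∈ I
    rw [map_add, mul_add]
    exact I.add_mem ha hb
  smul_mem' := by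
    intro r a ha
    change uElt f q ^ 2 * ofRes f q (r * a) ∈ I
    convert I.mul_mem_left (ofRes f q r) ha using 1
    rw [map_mul]
    ring

variable (f q)

/-- `G` is either `0`, or a unit of `𝒦` of the form `∑_{i=0}^{k-1} B_i(x) f(x)^i` where every
`B_i ∈ F[x]` is `0` or has degree less than `deg f`. -/
def IsZeroOrUnitPoly (k : ℕ) (G : F[X]) : Prop :=
  G = 0 ∨ (IsUnit (ofPoly f q G) ∧
    ∃ B : ℕ → F[X], (∀ i, B i ∈ Polynomial.degreeLT F f.natDegree) ∧
      G = ∑ i ∈ Finset.range k, B i * f ^ i)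

variable {f q}

/-- `I = ⟨u f^b + u² f^t G, u² f^c⟩` with the constraints on `t` and `G`. The inequality
`c + b - q ≤ t` is written without subtraction. -/
structure IsTypeII (I : Ideal (KRing f q)) (b c t : ℕ) (G : F[X]) : Prop where
  unit_G : IsZeroOrUnitPoly f q (c - t) G
  bound_t : G ≠ 0 → c + b ≤ q + t ∧ t < c
  eq_span : I = Ideal.span
    {uElt f q * ofPoly f q (f ^ b) + uElt f q ^ 2 * ofPoly f q (f ^ t * G),
     uElt f q ^ 2 * ofPoly f q (f ^ c)}

/-- `I = ⟨f^a + u f^t₁ D₁ + u² f^t₂ D₂, u f^b + u² f^θ V, u² f^c⟩` with the constraints on the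
parameters. The inequalities `a + b - q ≤ t₁` and `b + c - q ≤ θ` are written without
subtraction. -/
structure IsTypeIII (I : Ideal (KRing f q)) (a b c t₁ t₂ θ : ℕ) (D₁ D₂ V : F[X]) : Prop where
  unit_D₁ : IsZeroOrUnitPoly f q (b - t₁) D₁
  unit_D₂ : IsZeroOrUnitPoly f q (c - t₂) D₂
  unit_V : IsZeroOrUnitPoly f q (c - θ) V
  bound_t₁ : D₁ ≠ 0 → a + b ≤ q + t₁ ∧ t₁ < b
  bound_t₂ : D₂ ≠ 0 → t₂ < c
  bound_θ : V ≠ 0 → b + c ≤ q + θ ∧ θ < c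
  eq_span : I = Ideal.span
    {ofPoly f q (f ^ a) + uElt f q * ofPoly f q (f ^ t₁ * D₁)
        + uElt f q ^ 2 * ofPoly f q (f ^ t₂ * D₂),
     uElt f q * ofPoly f q (f ^ b) + uElt f q ^ 2 * ofPoly f q (f ^ θ * V),
     uElt f q ^ 2 * ofPoly f q (f ^ c)}

/-- `A ∈ F[x]/⟨f^q⟩` satisfies
`u² (f^{q-a+t₁-b+θ} V D₁ - f^{q-a+t₂} D₂) = u² f^c A` in `𝒦`.
If `V D₁ ≠ 0` then `a + b ≤ q + t₁`, so the first exponent is a true difference; otherwise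
the term vanishes. -/
def IsQuotientA (a b c t₁ t₂ θ : ℕ) (D₁ D₂ V : F[X]) (A : ResRing f q) : Prop :=
  uElt f q ^ 2 * ofPoly f q (f ^ (q + t₁ + θ - (a + b)) * V * D₁ - f ^ (q + t₂ - a) * D₂)
    = uElt f q ^ 2 * ofPoly f q (f ^ c) * ofRes f q A

end

end Constacyclic

namespace Constacyclic

/-! ### The ring `𝒦` as `S ⊕ uS ⊕ u²S`, where `S = F[x]/⟨f^q⟩`. -/

section Decomposition

variable {F : Type*} [Field F] {f : F[X]} {q : ℕ}

/-! Since `𝒦 = S[u]/⟨u³⟩`, the elements `1, u, u²` form an `S`-basis (`exists_decomposition`,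
`dvd_of_sum_eq_zero`), and every ideal of `S` is some `⟨f^i⟩` with `i ≤ q`. Filter `I` by powers of
`u`: the leading coefficients in the three layers form `⟨f^a⟩ ⊆ ⟨f^b⟩ ⊆ ⟨f^c⟩`, because
multiplication by `u` moves each layer into the next.

Any elements of `I` with leading terms `f^a`, `u f^b`, `u² f^c` act as a standard basis: stripping
leading terms writes each element of `I` uniquely with cofactors of bounded degree
(`HasExponents.exists_combination`, `HasExponents.natCard_eq`). This yields both generators and
cardinality. The lower coefficients are then reduced modulo `f^b` and `f^c` (`exists_reduced`); the
bounds on their exponents come from killing a leading term with a power of `f`.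

An annihilating element is determined layer by layer by testing it against `u² f^c`, then against
the second and first generators (`HasExponents.annihilator_eq`). Types I and II are the case `a =
q`, where the first generator can be taken to be `0`. -/

lemma uElt_pow_three : uElt f q ^ 3 = 0 := by
  have h : (AdjoinRoot.root ((Polynomial.X : F[X]) ^ 3)) ^ 3 = 0 := by
    rw [← AdjoinRoot.mk_X, ← map_pow, AdjoinRoot.mk_self]
  rw [uElt, ← map_pow, h, map_zero]

@[simp] lemma ofRes_mk (g : F[X]) : ofRes f q (AdjoinRoot.mk _ g) = ofPoly f q g := rfl

/-- The comparison map `𝒦 → S[u]/⟨u³⟩` with `S = F[x]/⟨f^q⟩`. -/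
noncomputable def toTower (f : F[X]) (q : ℕ) :
    KRing f q →+* AdjoinRoot ((Polynomial.X : (ResRing f q)[X]) ^ 3) :=
  AdjoinRoot.lift
    (AdjoinRoot.lift ((AdjoinRoot.of ((Polynomial.X : (ResRing f q)[X]) ^ 3)).comp
      (AdjoinRoot.of (f ^ q))) (AdjoinRoot.root _)
      (by rw [Polynomial.eval₂_X_pow, ← AdjoinRoot.mk_X, ← map_pow, AdjoinRoot.mk_self]))
    (AdjoinRoot.of _ (AdjoinRoot.root (f ^ q)))
    (by
      rw [Polynomial.eval₂_map, AdjoinRoot.lift_comp_of, ← Polynomial.hom_eval₂,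
        AdjoinRoot.eval₂_root, map_zero])

lemma toTower_uElt : toTower f q (uElt f q) = AdjoinRoot.root _ := by
  rw [uElt, toTower, AdjoinRoot.lift_of, AdjoinRoot.lift_root]

lemma toTower_ofPoly (g : F[X]) :
    toTower f q (ofPoly f q g) = AdjoinRoot.of _ (AdjoinRoot.mk (f ^ q) g) := by
  rw [ofPoly, toTower, RingHom.comp_apply, AdjoinRoot.lift_mk, Polynomial.coe_mapRingHom,
    Polynomial.eval₂_map, AdjoinRoot.lift_comp_of, ← Polynomial.hom_eval₂]
  exact congrArg _ (AdjoinRoot.aeval_eq g)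

lemma ofPoly_eq_zero_of_dvd {g : F[X]} (h : f ^ q ∣ g) : ofPoly f q g = 0 := by
  obtain ⟨k, rfl⟩ := h
  have h0 : ofPoly f q (f ^ q) = 0 := AdjoinRoot.mk_self
  rw [map_mul, h0, zero_mul]

lemma ofPoly_eq_of_dvd_sub {g h : F[X]} (hd : f ^ q ∣ g - h) : ofPoly f q g = ofPoly f q h := by
  rw [← sub_eq_zero, ← map_sub]
  exact ofPoly_eq_zero_of_dvd hd

/-- In the tower `S[u]/⟨u³⟩` the relation says that `X³` divides a polynomial of degree at most 2
over `S`, so its coefficients vanish. -/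
lemma dvd_of_sum_eq_zero {g₀ g₁ g₂ : F[X]}
    (h : ofPoly f q g₀ + uElt f q * ofPoly f q g₁ + uElt f q ^ 2 * ofPoly f q g₂ = 0) :
    f ^ q ∣ g₀ ∧ f ^ q ∣ g₁ ∧ f ^ q ∣ g₂ := by
  have h1 := congrArg (toTower f q) h
  simp only [map_add, map_mul, map_pow, toTower_uElt, toTower_ofPoly, map_zero] at h1
  rw [← AdjoinRoot.mk_C, ← AdjoinRoot.mk_C, ← AdjoinRoot.mk_C, ← AdjoinRoot.mk_X, ← map_pow,
    ← map_mul, ← map_mul, ← map_add, ← map_add, AdjoinRoot.mk_eq_zero,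
    Polynomial.X_pow_dvd_iff] at h1
  simp only [← AdjoinRoot.mk_eq_zero]
  refine ⟨?_, ?_, ?_⟩
  · simpa using h1 0 (by norm_num)
  · simpa [Polynomial.coeff_C, Polynomial.coeff_X_pow] using h1 1 (by norm_num)
  · simpa [Polynomial.coeff_C, Polynomial.coeff_X_pow, Polynomial.coeff_X] using
      h1 2 (by norm_num)

lemma ofPoly_eq_zero_iff {g : F[X]} : ofPoly f q g = 0 ↔ f ^ q ∣ g :=
  ⟨fun h => (dvd_of_sum_eq_zero (g₁ := 0) (g₂ := 0) (by simpa using h)).1, ofPoly_eq_zero_of_dvd⟩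

/-- Every element of `𝒦` has the form `g₀ + u g₁ + u² g₂`. -/
lemma exists_decomposition (k : KRing f q) : ∃ g₀ g₁ g₂ : F[X],
    k = ofPoly f q g₀ + uElt f q * ofPoly f q g₁ + uElt f q ^ 2 * ofPoly f q g₂ := by
  have hu := uElt_pow_three (f := f) (q := q)
  -- The set of such elements is closed under sums and products, so only constants, `u` and `x` need
  -- checking.
  have hmul : ∀ k l : KRing f q,
      (∃ g₀ g₁ g₂ : F[X], k =
        ofPoly f q g₀ + uElt f q * ofPoly f q g₁ + uElt f q ^ 2 * ofPoly f q g₂) →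
      (∃ g₀ g₁ g₂ : F[X], l =
        ofPoly f q g₀ + uElt f q * ofPoly f q g₁ + uElt f q ^ 2 * ofPoly f q g₂) →
      ∃ g₀ g₁ g₂ : F[X], k * l =
        ofPoly f q g₀ + uElt f q * ofPoly f q g₁ + uElt f q ^ 2 * ofPoly f q g₂ := by
    rintro _ _ ⟨a, b, c, rfl⟩ ⟨x, y, z, rfl⟩
    refine ⟨a * x, a * y + b * x, a * z + b * y + c * x, ?_⟩
    simp only [map_add, map_mul]
    linear_combination (ofPoly f q b * ofPoly f q z + ofPoly f q c * ofPoly f q y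
      + uElt f q * ofPoly f q c * ofPoly f q z) * hu
  have hadd : ∀ k l : KRing f q,
      (∃ g₀ g₁ g₂ : F[X], k =
        ofPoly f q g₀ + uElt f q * ofPoly f q g₁ + uElt f q ^ 2 * ofPoly f q g₂) →
      (∃ g₀ g₁ g₂ : F[X], l =
        ofPoly f q g₀ + uElt f q * ofPoly f q g₁ + uElt f q ^ 2 * ofPoly f q g₂) →
      ∃ g₀ g₁ g₂ : F[X], k + l =
        ofPoly f q g₀ + uElt f q * ofPoly f q g₁ + uElt f q ^ 2 * ofPoly f q g₂ := by
    rintro _ _ ⟨a, b, c, rfl⟩ ⟨x, y, z, rfl⟩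
    refine ⟨a + x, b + y, c + z, ?_⟩
    simp only [map_add]
    ring
  induction k using AdjoinRoot.induction_on with
  | ih P =>
    induction P using Polynomial.induction_on with
    | C r =>
      induction r using AdjoinRoot.induction_on with
      | ih g =>
        induction g using Polynomial.induction_on with
        | C x => exact ⟨Polynomial.C x, 0, 0, by simp [ofPoly]⟩
        | add g h hg hh =>
          simp only [map_add]
          exact hadd _ _ hg hh
        | monomial n x ih =>
          rw [pow_succ Polynomial.X n, ← mul_assoc, map_mul, map_mul, map_mul]
          exact hmul _ _ ih ⟨0, 1, 0, by simp [uElt]⟩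
    | add g h hg hh =>
      simp only [map_add]
      exact hadd _ _ hg hh
    | monomial n x ih =>
      rw [pow_succ Polynomial.X n, ← mul_assoc, map_mul]
      exact hmul _ _ ih ⟨Polynomial.X, 0, 0, by simp [ofPoly]⟩

lemma isUnit_ofPoly (hf : Irreducible f) {g : F[X]} (hg : ¬ f ∣ g) : IsUnit (ofPoly f q g) := by
  obtain ⟨x, y, h⟩ := (((Irreducible.coprime_iff_not_dvd hf).2 hg).pow_left (m := q)).symm
  refine IsUnit.of_mul_eq_one (ofPoly f q x) ?_
  have h1 := congrArg (ofPoly f q) h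
  rw [map_add, map_mul, map_mul, ofPoly_eq_zero_of_dvd dvd_rfl, mul_zero, add_zero, map_one] at h1
  rw [mul_comm, h1]

end Decomposition

/-! ### The exponents `a, b, c` of an ideal. -/

section Exponents

variable {F : Type*} [Field F] {f : F[X]} {q : ℕ}

/-- The exponents of the three `S`-ideals attached to `I`, expressed by divisibility in `F[x]`. -/
structure HasExponents (I : Ideal (KRing f q)) (a b c : ℕ) : Prop where
  hcb : c ≤ b
  hba : b ≤ a
  haq : a ≤ q
  res : ∀ g : F[X], (∃ g₁ g₂, ofPoly f q g + uElt f q * ofPoly f q g₁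
    + uElt f q ^ 2 * ofPoly f q g₂ ∈ I) ↔ f ^ a ∣ g
  tor : ∀ g : F[X], (∃ g₂, uElt f q * ofPoly f q g + uElt f q ^ 2 * ofPoly f q g₂ ∈ I) ↔ f ^ b ∣ g
  tor2 : ∀ g : F[X], uElt f q ^ 2 * ofPoly f q g ∈ I ↔ f ^ c ∣ g

/-- As `f^a ∣ f^q`, divisibility by `f^a` does not depend on the representative modulo `f^q`. -/
lemma mk_mem_span_pow {a : ℕ} (ha : a ≤ q) (g : F[X]) :
    AdjoinRoot.mk (f ^ q) g ∈ Ideal.span {AdjoinRoot.mk (f ^ q) (f ^ a)} ↔ f ^ a ∣ g := by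
  rw [Ideal.mem_span_singleton]
  constructor
  · rintro ⟨k, hk⟩
    obtain ⟨k, rfl⟩ := AdjoinRoot.mk_surjective k
    rw [← map_mul, AdjoinRoot.mk_eq_mk] at hk
    have := (pow_dvd_pow f ha).trans hk
    simpa using dvd_add this (dvd_mul_right (f ^ a) k)
  · exact fun h => map_dvd _ h

lemma mem_ResU_iff (I : Ideal (KRing f q)) (g : F[X]) : AdjoinRoot.mk _ g ∈ ResU I ↔
    ∃ g₁ g₂, ofPoly f q g + uElt f q * ofPoly f q g₁ + uElt f q ^ 2 * ofPoly f q g₂ ∈ I := by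
  constructor
  · rintro ⟨x, y, h⟩
    obtain ⟨x, rfl⟩ := AdjoinRoot.mk_surjective x
    obtain ⟨y, rfl⟩ := AdjoinRoot.mk_surjective y
    exact ⟨x, y, h⟩
  · rintro ⟨x, y, h⟩
    exact ⟨AdjoinRoot.mk _ x, AdjoinRoot.mk _ y, h⟩

lemma mem_TorU_iff (I : Ideal (KRing f q)) (g : F[X]) : AdjoinRoot.mk _ g ∈ TorU I ↔
    ∃ g₂, uElt f q * ofPoly f q g + uElt f q ^ 2 * ofPoly f q g₂ ∈ I := by
  constructor
  · rintro ⟨y, h⟩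
    obtain ⟨y, rfl⟩ := AdjoinRoot.mk_surjective y
    exact ⟨y, h⟩
  · rintro ⟨y, h⟩
    exact ⟨AdjoinRoot.mk _ y, h⟩

lemma mem_TorU2_iff (I : Ideal (KRing f q)) (g : F[X]) :
    AdjoinRoot.mk _ g ∈ TorU2 I ↔ uElt f q ^ 2 * ofPoly f q g ∈ I := Iff.rfl

lemma HasExponents.of_eq {I : Ideal (KRing f q)} {a b c : ℕ} (hcb : c ≤ b) (hba : b ≤ a)
    (haq : a ≤ q) (hr : ResU I = Ideal.span {AdjoinRoot.mk _ (f ^ a)})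
    (ht : TorU I = Ideal.span {AdjoinRoot.mk _ (f ^ b)})
    (ht2 : TorU2 I = Ideal.span {AdjoinRoot.mk _ (f ^ c)}) : HasExponents I a b c where
  hcb := hcb
  hba := hba
  haq := haq
  res g := by rw [← mem_ResU_iff, hr, mk_mem_span_pow haq]
  tor g := by rw [← mem_TorU_iff, ht, mk_mem_span_pow (hba.trans haq)]
  tor2 g := by rw [← mem_TorU2_iff, ht2, mk_mem_span_pow (hcb.trans (hba.trans haq))]

/-- Every ideal of `F[x]/⟨f^q⟩` is generated by a power of `f`. -/
lemma exists_eq_span_pow (hf : Irreducible f) (J : Ideal (ResRing f q)) :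
    ∃ a ≤ q, J = Ideal.span {AdjoinRoot.mk _ (f ^ a)} := by
  have hsurj : Function.Surjective (AdjoinRoot.mk (f ^ q)) := AdjoinRoot.mk_surjective
  -- The preimage in the principal ideal domain `F[x]` contains `f^q`, so its generator is
  -- associated to a power of `f`.
  obtain ⟨h, hh⟩ := (IsPrincipalIdealRing.principal (J.comap (AdjoinRoot.mk (f ^ q)))).principal
  have hmem : f ^ q ∈ J.comap (AdjoinRoot.mk (f ^ q)) := by
    rw [Ideal.mem_comap, AdjoinRoot.mk_self]
    exact J.zero_mem
  rw [hh] at hmem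
  obtain ⟨a, ha, hassoc⟩ := (dvd_prime_pow hf.prime q).1 (Ideal.mem_span_singleton.1 hmem)
  refine ⟨a, ha, ?_⟩
  rw [← Ideal.map_comap_of_surjective _ hsurj J, hh, Ideal.submodule_span_eq,
    Ideal.span_singleton_eq_span_singleton.2 hassoc, Ideal.map_span, Set.image_singleton]

/-- Multiplying a witness by `u` shifts it one layer and, by `u³ = 0`, drops the last term; this
gives `c ≤ b ≤ a`. -/
lemma exists_exponents (hf : Irreducible f) (I : Ideal (KRing f q)) :
    ∃ a b c : ℕ, c ≤ b ∧ b ≤ a ∧ a ≤ q ∧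
      ResU I = Ideal.span {AdjoinRoot.mk _ (f ^ a)} ∧
      TorU I = Ideal.span {AdjoinRoot.mk _ (f ^ b)} ∧
      TorU2 I = Ideal.span {AdjoinRoot.mk _ (f ^ c)} := by
  obtain ⟨a, ha, hr⟩ := exists_eq_span_pow hf (ResU I)
  obtain ⟨b, hb, ht⟩ := exists_eq_span_pow hf (TorU I)
  obtain ⟨c, hc, ht2⟩ := exists_eq_span_pow hf (TorU2 I)
  have hu := uElt_pow_three (f := f) (q := q)
  refine ⟨a, b, c, ?_, ?_, ha, hr, ht, ht2⟩
  · have h1 : AdjoinRoot.mk _ (f ^ b) ∈ TorU I := ht ▸ Ideal.mem_span_singleton_self _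
    obtain ⟨y, h⟩ := (mem_TorU_iff I _).1 h1
    have h2 : AdjoinRoot.mk _ (f ^ b) ∈ TorU2 I := by
      rw [mem_TorU2_iff]
      convert I.mul_mem_left (uElt f q) h using 1
      linear_combination -ofPoly f q y * hu
    rw [ht2, mk_mem_span_pow hc] at h2
    exact (pow_dvd_pow_iff hf.ne_zero hf.not_isUnit).1 h2
  · have h1 : AdjoinRoot.mk _ (f ^ a) ∈ ResU I := hr ▸ Ideal.mem_span_singleton_self _
    obtain ⟨x, y, h⟩ := (mem_ResU_iff I _).1 h1
    have h2 : AdjoinRoot.mk _ (f ^ a) ∈ TorU I := by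
      rw [mem_TorU_iff]
      refine ⟨x, ?_⟩
      convert I.mul_mem_left (uElt f q) h using 1
      linear_combination -ofPoly f q y * hu
    rw [ht, mk_mem_span_pow hb] at h2
    exact (pow_dvd_pow_iff hf.ne_zero hf.not_isUnit).1 h2

end Exponents

/-! ### Standard generators and cardinality. -/

section Generators

variable {F : Type*} [Field F] {f : F[X]} {q : ℕ} {I : Ideal (KRing f q)} {a b c : ℕ}

/-- Multiples of `f^a` modulo `f^q` have a representative `f^a x` with `x` of small degree. -/
lemma exists_small_cofactor (hm : f.Monic) (ha : a ≤ q) {g : F[X]} (hg : f ^ a ∣ g) :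
    ∃ x ∈ Polynomial.degreeLT F (f.natDegree * (q - a)), f ^ q ∣ g - f ^ a * x := by
  obtain ⟨y, rfl⟩ := hg
  refine ⟨y %ₘ f ^ (q - a), ?_, y /ₘ f ^ (q - a), ?_⟩
  · rw [Polynomial.mem_degreeLT, mul_comm, ← hm.natDegree_pow,
      ← Polynomial.degree_eq_natDegree (hm.pow _).ne_zero]
    exact Polynomial.degree_modByMonic_lt _ (hm.pow _)
  · have h := Polynomial.modByMonic_add_div y (f ^ (q - a))
    rw [← pow_sub_mul_pow f ha]
    linear_combination -f ^ a * h

/-- Elements with leading terms `f^a`, `u f^b`, `u² f^c` generate `I`, with small cofactors. -/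
lemma HasExponents.exists_combination (hm : f.Monic) (h : HasExponents I a b c) {h₁ h₂ v : F[X]}
    (m₁ : ofPoly f q (f ^ a) + uElt f q * ofPoly f q h₁ + uElt f q ^ 2 * ofPoly f q h₂ ∈ I)
    (m₂ : uElt f q * ofPoly f q (f ^ b) + uElt f q ^ 2 * ofPoly f q v ∈ I)
    {k : KRing f q} (hk : k ∈ I) :
    ∃ x ∈ Polynomial.degreeLT F (f.natDegree * (q - a)),
    ∃ y ∈ Polynomial.degreeLT F (f.natDegree * (q - b)),
    ∃ z ∈ Polynomial.degreeLT F (f.natDegree * (q - c)),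
      ofPoly f q x * (ofPoly f q (f ^ a) + uElt f q * ofPoly f q h₁ + uElt f q ^ 2 * ofPoly f q h₂)
      + ofPoly f q y * (uElt f q * ofPoly f q (f ^ b) + uElt f q ^ 2 * ofPoly f q v)
      + ofPoly f q z * (uElt f q ^ 2 * ofPoly f q (f ^ c)) = k := by
  obtain ⟨k₀, k₁, k₂, rfl⟩ := exists_decomposition k
  -- Cancel the coefficient of `1`, then of `u`, then of `u²`; each remainder lies in the next layer
  -- of `I`.
  obtain ⟨x, hx, ex⟩ := exists_small_cofactor hm h.haq ((h.res k₀).1 ⟨k₁, k₂, hk⟩)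
  replace ex := ofPoly_eq_of_dvd_sub ex
  have r₁ : uElt f q * ofPoly f q (k₁ - x * h₁) + uElt f q ^ 2 * ofPoly f q (k₂ - x * h₂) ∈ I := by
    convert I.sub_mem hk (I.mul_mem_left (ofPoly f q x) m₁) using 1
    simp only [map_sub, map_mul] at ex ⊢
    linear_combination -ex
  obtain ⟨y, hy, ey⟩ := exists_small_cofactor hm (h.hba.trans h.haq) ((h.tor _).1 ⟨_, r₁⟩)
  replace ey := ofPoly_eq_of_dvd_sub ey
  have r₂ : uElt f q ^ 2 * ofPoly f q (k₂ - x * h₂ - y * v) ∈ I := by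
    convert I.sub_mem r₁ (I.mul_mem_left (ofPoly f q y) m₂) using 1
    simp only [map_sub, map_mul] at ey ⊢
    linear_combination -uElt f q * ey
  obtain ⟨z, hz, ez⟩ := exists_small_cofactor hm (h.hcb.trans (h.hba.trans h.haq)) ((h.tor2 _).1 r₂)
  replace ez := ofPoly_eq_of_dvd_sub ez
  refine ⟨x, hx, y, hy, z, hz, ?_⟩
  simp only [map_sub, map_mul] at ex ey ez ⊢
  linear_combination -ex - uElt f q * ey - uElt f q ^ 2 * ez

lemma HasExponents.eq_span (hm : f.Monic) (h : HasExponents I a b c) {h₁ h₂ v : F[X]}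
    (m₁ : ofPoly f q (f ^ a) + uElt f q * ofPoly f q h₁ + uElt f q ^ 2 * ofPoly f q h₂ ∈ I)
    (m₂ : uElt f q * ofPoly f q (f ^ b) + uElt f q ^ 2 * ofPoly f q v ∈ I) :
    I = Ideal.span
      {ofPoly f q (f ^ a) + uElt f q * ofPoly f q h₁ + uElt f q ^ 2 * ofPoly f q h₂,
       uElt f q * ofPoly f q (f ^ b) + uElt f q ^ 2 * ofPoly f q v,
       uElt f q ^ 2 * ofPoly f q (f ^ c)} := by
  refine le_antisymm (fun k hk => ?_) (Ideal.span_le.2 ?_)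
  · obtain ⟨x, -, y, -, z, -, rfl⟩ := h.exists_combination hm m₁ m₂ hk
    refine Ideal.add_mem _ (Ideal.add_mem _ ?_ ?_) ?_ <;>
    exact Ideal.mul_mem_left _ _ (Ideal.subset_span (by simp))
  · rintro _ (rfl | rfl | rfl)
    exacts [m₁, m₂, (h.tor2 _).2 dvd_rfl]

lemma natCard_degreeLT (n : ℕ) : Nat.card (Polynomial.degreeLT F n) = Nat.card F ^ n := by
  rw [Nat.card_congr (Polynomial.degreeLTEquiv F n).toEquiv, Nat.card_fun, Nat.card_fin]

lemma eq_zero_of_small_cofactor (hm : f.Monic) (ha : a ≤ q) {x : F[X]}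
    (hx : x ∈ Polynomial.degreeLT F (f.natDegree * (q - a))) (hd : f ^ q ∣ x * f ^ a) : x = 0 := by
  rw [← pow_sub_mul_pow f ha] at hd
  refine Polynomial.eq_zero_of_dvd_of_degree_lt
    ((mul_dvd_mul_iff_right (pow_ne_zero a hm.ne_zero)).1 hd) ?_
  rwa [Polynomial.degree_eq_natDegree (hm.pow _).ne_zero, hm.natDegree_pow, mul_comm,
    ← Polynomial.mem_degreeLT]

lemma HasExponents.exists_generators (h : HasExponents I a b c) : ∃ h₁ h₂ v : F[X],
    ofPoly f q (f ^ a) + uElt f q * ofPoly f q h₁ + uElt f q ^ 2 * ofPoly f q h₂ ∈ I ∧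
    uElt f q * ofPoly f q (f ^ b) + uElt f q ^ 2 * ofPoly f q v ∈ I := by
  obtain ⟨h₁, h₂, m₁⟩ := (h.res (f ^ a)).2 dvd_rfl
  obtain ⟨v, m₂⟩ := (h.tor (f ^ b)).2 dvd_rfl
  exact ⟨h₁, h₂, v, m₁, m₂⟩

/-- Triples of cofactors of bounded degree are coordinates on `I`, of total dimension `d(q-a) +
d(q-b) + d(q-c)` over `F`, where `d` is the degree of `f`. -/
lemma HasExponents.natCard_eq (hm : f.Monic) (h : HasExponents I a b c) :
    Nat.card I = Nat.card F ^ (f.natDegree * (3 * q - a - b - c)) := by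
  obtain ⟨h₁, h₂, v, m₁, m₂⟩ := h.exists_generators
  have hcb := h.hcb
  have hba := h.hba
  have haq := h.haq
  let φ : Polynomial.degreeLT F (f.natDegree * (q - a)) ×
      Polynomial.degreeLT F (f.natDegree * (q - b)) ×
      Polynomial.degreeLT F (f.natDegree * (q - c)) → I := fun w =>
    ⟨ofPoly f q w.1 * (ofPoly f q (f ^ a) + uElt f q * ofPoly f q h₁
        + uElt f q ^ 2 * ofPoly f q h₂)
      + ofPoly f q w.2.1 * (uElt f q * ofPoly f q (f ^ b) + uElt f q ^ 2 * ofPoly f q v)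
      + ofPoly f q w.2.2 * (uElt f q ^ 2 * ofPoly f q (f ^ c)),
      I.add_mem (I.add_mem (I.mul_mem_left _ m₁) (I.mul_mem_left _ m₂))
        (I.mul_mem_left _ ((h.tor2 _).2 dvd_rfl))⟩
  have hφ : Function.Bijective φ := by
    constructor
    · rintro ⟨⟨x, hx⟩, ⟨y, hy⟩, ⟨z, hz⟩⟩ ⟨⟨x', hx'⟩, ⟨y', hy'⟩, ⟨z', hz'⟩⟩ he
      replace he := congrArg Subtype.val he
      simp only [φ] at he
      -- The system is triangular: the coefficient of `1` forces `x = x'`, then that of `u` forces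
      -- `y = y'`, and that of `u²` forces `z = z'`.
      obtain ⟨d₀, d₁, d₂⟩ := dvd_of_sum_eq_zero (g₀ := (x - x') * f ^ a)
        (g₁ := (x - x') * h₁ + (y - y') * f ^ b)
        (g₂ := (x - x') * h₂ + (y - y') * v + (z - z') * f ^ c) (by
          simp only [map_sub, map_mul, map_add] at he ⊢
          linear_combination he)
      have e₀ := eq_zero_of_small_cofactor hm haq (Submodule.sub_mem _ hx hx') d₀
      rw [e₀, zero_mul, zero_add] at d₁ d₂
      have e₁ := eq_zero_of_small_cofactor hm (hba.trans haq) (Submodule.sub_mem _ hy hy') d₁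
      rw [e₁, zero_mul, zero_add] at d₂
      have e₂ := eq_zero_of_small_cofactor hm (hcb.trans (hba.trans haq))
        (Submodule.sub_mem _ hz hz') d₂
      rw [sub_eq_zero] at e₀ e₁ e₂
      subst e₀ e₁ e₂
      rfl
    · rintro ⟨k, hk⟩
      obtain ⟨x, hx, y, hy, z, hz, e⟩ := h.exists_combination hm m₁ m₂ hk
      exact ⟨⟨⟨x, hx⟩, ⟨y, hy⟩, ⟨z, hz⟩⟩, Subtype.ext e⟩
  rw [← Nat.card_congr (Equiv.ofBijective φ hφ), Nat.card_prod, Nat.card_prod, natCard_degreeLT,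
    natCard_degreeLT, natCard_degreeLT, ← pow_add, ← pow_add, ← mul_add, ← mul_add]
  congr 2
  omega

end Generators

/-! ### The annihilator in terms of standard generators. -/

section Annihilator

variable {F : Type*} [Field F] {f : F[X]} {q : ℕ} {I : Ideal (KRing f q)} {a b c : ℕ}

/-- If `f^q` divides `g f^i` and `i ≤ q`, then `g` is a multiple of `f^(q-i)`. -/
lemma exists_eq_of_pow_dvd_mul (hf : f ≠ 0) {i : ℕ} (hi : i ≤ q) {g : F[X]}
    (h : f ^ q ∣ g * f ^ i) : ∃ y, g = f ^ (q - i) * y := by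
  rw [← pow_sub_mul_pow f hi] at h
  exact (mul_dvd_mul_iff_right (pow_ne_zero i hf)).1 h

/-- `w₁` and `w₂` are the quotients `f^(q-c) v / f^b` and `f^(q-b) h₁ / f^a`, stated without
division. `hA` is the vanishing of the `u²` coefficient in the product of the first generators of
the two ideals. -/
lemma HasExponents.annihilator_eq (hf : f ≠ 0) (h : HasExponents I a b c)
    {h₁ h₂ v w₁ w₂ A : F[X]}
    (hI : I = Ideal.span
      {ofPoly f q (f ^ a) + uElt f q * ofPoly f q h₁ + uElt f q ^ 2 * ofPoly f q h₂,
       uElt f q * ofPoly f q (f ^ b) + uElt f q ^ 2 * ofPoly f q v,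
       uElt f q ^ 2 * ofPoly f q (f ^ c)})
    (hw₁ : f ^ b * w₁ = f ^ (q - c) * v) (hw₂ : f ^ a * w₂ = f ^ (q - b) * h₁)
    (hA : f ^ q ∣ f ^ (q - c) * h₂ - w₁ * h₁ + f ^ a * A) :
    Submodule.annihilator I = Ideal.span
      {ofPoly f q (f ^ (q - c)) - uElt f q * ofPoly f q w₁ + uElt f q ^ 2 * ofPoly f q A,
       uElt f q * ofPoly f q (f ^ (q - b)) - uElt f q ^ 2 * ofPoly f q w₂,
       uElt f q ^ 2 * ofPoly f q (f ^ (q - a))} := by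
  have hu := uElt_pow_three (f := f) (q := q)
  have hcb := h.hcb
  have hba := h.hba
  have haq := h.haq
  set U := uElt f q
  have m₁ : ofPoly f q (f ^ a) + U * ofPoly f q h₁ + U ^ 2 * ofPoly f q h₂ ∈ I := by
    rw [hI]; exact Ideal.subset_span (by simp)
  have m₂ : U * ofPoly f q (f ^ b) + U ^ 2 * ofPoly f q v ∈ I := by
    rw [hI]; exact Ideal.subset_span (by simp)
  have m₃ : U ^ 2 * ofPoly f q (f ^ c) ∈ I := (h.tor2 _).2 dvd_rfl
  have hz : ∀ i j : ℕ, q ≤ i + j → ofPoly f q (f ^ i) * ofPoly f q (f ^ j) = 0 := by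
    intro i j hij
    rw [← map_mul, ← pow_add]
    exact ofPoly_eq_zero_of_dvd (pow_dvd_pow f hij)
  have e₁ : ofPoly f q (f ^ b) * ofPoly f q w₁ = ofPoly f q (f ^ (q - c)) * ofPoly f q v := by
    rw [← map_mul, hw₁, map_mul]
  have e₂ : ofPoly f q (f ^ a) * ofPoly f q w₂ = ofPoly f q (f ^ (q - b)) * ofPoly f q h₁ := by
    rw [← map_mul, hw₂, map_mul]
  have e₃ := ofPoly_eq_zero_of_dvd hA
  -- This is the `u` coefficient of that product. `u` times the first generator minus `f^(a-b)`
  -- times the second lies in `I ∩ u²𝒦`, so `f^c ∣ h₁ - f^(a-b) v`; multiply by `f^(q-c)`.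
  have e₄ : ofPoly f q (f ^ (q - c)) * ofPoly f q h₁ = ofPoly f q (f ^ a) * ofPoly f q w₁ := by
    have hm : U ^ 2 * ofPoly f q (h₁ - f ^ (a - b) * v) ∈ I := by
      convert I.sub_mem (I.mul_mem_left U m₁) (I.mul_mem_left (ofPoly f q (f ^ (a - b))) m₂) using 1
      have e : ofPoly f q (f ^ a) = ofPoly f q (f ^ (a - b)) * ofPoly f q (f ^ b) := by
        rw [← map_mul, pow_sub_mul_pow f hba]
      rw [map_sub, map_mul]
      linear_combination -U * e - ofPoly f q h₂ * hu
    obtain ⟨y, hy⟩ := (h.tor2 _).1 hm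
    rw [← map_mul, ← map_mul]
    refine ofPoly_eq_of_dvd_sub ⟨y, ?_⟩
    rw [← pow_sub_mul_pow f (hcb.trans (hba.trans haq)), ← pow_sub_mul_pow f hba]
    linear_combination f ^ (q - c) * hy - f ^ (a - b) * hw₁
  simp only [map_sub, map_add, map_mul] at e₃
  have n_mem : ∀ r, r * (ofPoly f q (f ^ a) + U * ofPoly f q h₁ + U ^ 2 * ofPoly f q h₂) = 0 →
      r * (U * ofPoly f q (f ^ b) + U ^ 2 * ofPoly f q v) = 0 →
      r * (U ^ 2 * ofPoly f q (f ^ c)) = 0 → r ∈ Submodule.annihilator I := by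
    intro r r₁ r₂ r₃
    rw [hI, Submodule.mem_annihilator_span]
    rintro ⟨_, rfl | rfl | rfl⟩
    exacts [r₁, r₂, r₃]
  have n₁ : ofPoly f q (f ^ (q - c)) - U * ofPoly f q w₁ + U ^ 2 * ofPoly f q A
      ∈ Submodule.annihilator I := by
    apply n_mem
    · linear_combination hz (q - c) a (by omega) + U * e₄ + U ^ 2 * e₃
        + (ofPoly f q A * ofPoly f q h₁ - ofPoly f q w₁ * ofPoly f q h₂
          + U * ofPoly f q A * ofPoly f q h₂) * hu
    · linear_combination U * hz (q - c) b (by omega) - U ^ 2 * e₁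
        + (ofPoly f q A * ofPoly f q (f ^ b) - ofPoly f q w₁ * ofPoly f q v
          + U * ofPoly f q A * ofPoly f q v) * hu
    · linear_combination U ^ 2 * hz (q - c) c (by omega)
        + (U * ofPoly f q A - ofPoly f q w₁) * ofPoly f q (f ^ c) * hu
  have n₂ : U * ofPoly f q (f ^ (q - b)) - U ^ 2 * ofPoly f q w₂ ∈ Submodule.annihilator I := by
    apply n_mem
    · linear_combination U * hz (q - b) a (by omega) - U ^ 2 * e₂
        + (ofPoly f q (f ^ (q - b)) * ofPoly f q h₂ - ofPoly f q w₂ * ofPoly f q h₁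
          - U * ofPoly f q w₂ * ofPoly f q h₂) * hu
    · linear_combination U ^ 2 * hz (q - b) b (by omega)
        + (ofPoly f q (f ^ (q - b)) * ofPoly f q v - ofPoly f q w₂ * ofPoly f q (f ^ b)
          - U * ofPoly f q w₂ * ofPoly f q v) * hu
    · linear_combination (ofPoly f q (f ^ (q - b)) - U * ofPoly f q w₂) * ofPoly f q (f ^ c) * hu
  have n₃ : U ^ 2 * ofPoly f q (f ^ (q - a)) ∈ Submodule.annihilator I := by
    apply n_mem
    · linear_combination U ^ 2 * hz (q - a) a (by omega)
        + ofPoly f q (f ^ (q - a)) * (ofPoly f q h₁ + U * ofPoly f q h₂) * hu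
    · linear_combination ofPoly f q (f ^ (q - a)) * (ofPoly f q (f ^ b) + U * ofPoly f q v) * hu
    · linear_combination U * ofPoly f q (f ^ (q - a)) * ofPoly f q (f ^ c) * hu
  apply le_antisymm
  · intro k hk
    obtain ⟨k₀, k₁, k₂, rfl⟩ := exists_decomposition k
    -- Testing against `u² f^c` gives `k₀ = f^(q-c) x`. Subtracting `x` times the first proposed
    -- generator leaves no constant term, and the remaining two tests treat `u` and `u²` likewise.
    have s₀ := Submodule.mem_annihilator.1 hk _ m₃
    obtain ⟨-, -, d⟩ := dvd_of_sum_eq_zero (f := f) (q := q) (g₀ := 0) (g₁ := 0)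
      (g₂ := k₀ * f ^ c) (by
        simp only [map_zero, map_mul, smul_eq_mul] at s₀ ⊢
        linear_combination s₀ - ofPoly f q (f ^ c) * (ofPoly f q k₁ + U * ofPoly f q k₂) * hu)
    obtain ⟨x, rfl⟩ := exists_eq_of_pow_dvd_mul hf (hcb.trans (hba.trans haq)) d
    have hk₁ := sub_mem hk (Ideal.mul_mem_left _ (ofPoly f q x) n₁)
    have s₁ := Submodule.mem_annihilator.1 hk₁ _ m₂
    obtain ⟨-, -, d⟩ := dvd_of_sum_eq_zero (f := f) (q := q) (g₀ := 0) (g₁ := 0)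
      (g₂ := (k₁ + x * w₁) * f ^ b) (by
        simp only [map_zero, map_mul, map_add, smul_eq_mul] at s₁ ⊢
        linear_combination s₁ - ((ofPoly f q k₁ + ofPoly f q x * ofPoly f q w₁) * ofPoly f q v
          + (ofPoly f q k₂ - ofPoly f q x * ofPoly f q A)
            * (ofPoly f q (f ^ b) + U * ofPoly f q v)) * hu)
    obtain ⟨y, hy⟩ := exists_eq_of_pow_dvd_mul hf (hba.trans haq) d
    have ey := congrArg (ofPoly f q) hy
    have hk₂ := sub_mem hk₁ (Ideal.mul_mem_left _ (ofPoly f q y) n₂)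
    have s₂ := Submodule.mem_annihilator.1 hk₂ _ m₁
    simp only [map_mul, map_add, smul_eq_mul] at s₂ ey
    obtain ⟨-, -, d⟩ := dvd_of_sum_eq_zero (f := f) (q := q) (g₀ := 0) (g₁ := 0)
      (g₂ := (k₂ - x * A + y * w₂) * f ^ a) (by
        simp only [map_zero, map_mul, map_add, map_sub]
        linear_combination s₂
          - U * (ofPoly f q (f ^ a) + U * ofPoly f q h₁ + U ^ 2 * ofPoly f q h₂) * ey
          - (ofPoly f q k₂ - ofPoly f q x * ofPoly f q A + ofPoly f q y * ofPoly f q w₂)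
            * (ofPoly f q h₁ + U * ofPoly f q h₂) * hu)
    obtain ⟨z, hz'⟩ := exists_eq_of_pow_dvd_mul hf haq d
    have ez := congrArg (ofPoly f q) hz'
    simp only [map_mul, map_add, map_sub] at ez
    rw [Ideal.mem_span_insert]
    refine ⟨ofPoly f q x, _, Ideal.mem_span_pair.2 ⟨ofPoly f q y, ofPoly f q z, rfl⟩, ?_⟩
    simp only [map_mul]
    linear_combination U * ey + U ^ 2 * ez
  · rw [Ideal.span_le]
    rintro _ (rfl | rfl | rfl)
    exacts [n₁, n₂, n₃]

end Annihilator

/-! ### Reduced coefficients `f^t G`. -/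

section Digits

variable {F : Type*} [Field F] {f : F[X]} {q : ℕ}

/-- Expansion in base `f`. -/
lemma exists_digits (hm : f.Monic) (k : ℕ) {g : F[X]}
    (hg : g.degree < (f.natDegree * k : ℕ)) :
    ∃ B : ℕ → F[X], (∀ i, B i ∈ Polynomial.degreeLT F f.natDegree) ∧
      g = ∑ i ∈ Finset.range k, B i * f ^ i := by
  induction k generalizing g with
  | zero =>
    refine ⟨0, fun i => Submodule.zero_mem _, ?_⟩
    rw [mul_zero, Polynomial.degree_lt_iff_coeff_zero] at hg
    ext i
    simpa using hg i (Nat.zero_le i)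
  | succ k ih =>
    obtain ⟨B, hB, e⟩ := ih (g := g /ₘ f) (by
      by_cases h0 : g /ₘ f = 0
      · rw [h0, Polynomial.degree_zero]
        exact WithBot.bot_lt_coe _
      · have hlt : ¬ g.degree < f.degree := fun h =>
          h0 ((Polynomial.divByMonic_eq_zero_iff hm).2 h)
        have hg0 : g ≠ 0 := by
          rintro rfl
          simp at h0
        rw [Polynomial.degree_eq_natDegree h0, Polynomial.natDegree_divByMonic g hm, Nat.cast_lt]
        rw [Polynomial.degree_eq_natDegree hg0, Nat.cast_lt] at hg
        rw [Polynomial.degree_eq_natDegree hg0, Polynomial.degree_eq_natDegree hm.ne_zero,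
          Nat.cast_lt] at hlt
        rw [mul_add] at hg
        omega)
    refine ⟨fun i => Nat.casesOn i (g %ₘ f) B, ?_, ?_⟩
    · rintro (_ | i)
      · rw [Polynomial.mem_degreeLT, ← Polynomial.degree_eq_natDegree hm.ne_zero]
        exact Polynomial.degree_modByMonic_lt _ hm
      · exact hB i
    · rw [Finset.sum_range_succ']
      have h := Polynomial.modByMonic_add_div g f
      simp only [pow_succ, ← mul_assoc, ← Finset.sum_mul, ← e, pow_zero, mul_one]
      linear_combination -h

/-- Modulo `f^k`, every polynomial is `f^t G` with `G` zero or a unit of bounded length. -/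
lemma exists_reduced (hm : f.Monic) (hf : Irreducible f) (k : ℕ) (h : F[X]) :
    ∃ (t : ℕ) (G : F[X]), IsZeroOrUnitPoly f q (k - t) G ∧ (G ≠ 0 → t < k ∧ ¬ f ∣ G) ∧
      f ^ k ∣ h - f ^ t * G := by
  have hd : 0 < f.natDegree := hf.natDegree_pos
  have hdiv := Polynomial.modByMonic_add_div h (f ^ k)
  by_cases h0 : h %ₘ f ^ k = 0
  · refine ⟨0, 0, Or.inl rfl, fun h => absurd rfl h, h /ₘ f ^ k, ?_⟩
    rw [h0] at hdiv
    linear_combination -hdiv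
  · obtain ⟨G, e, hG⟩ := (Polynomial.finiteMultiplicity_of_degree_pos_of_monic
      (Polynomial.natDegree_pos_iff_degree_pos.1 hd) hm h0).exists_eq_pow_mul_and_not_dvd
    generalize multiplicity f (h %ₘ f ^ k) = t at e
    have hG0 : G ≠ 0 := by
      rintro rfl
      simp at hG
    have hlt := Polynomial.degree_modByMonic_lt h (hm.pow k)
    rw [Polynomial.degree_eq_natDegree h0, Polynomial.degree_eq_natDegree (hm.pow k).ne_zero,
      Nat.cast_lt, e, (hm.pow t).natDegree_mul' hG0, hm.natDegree_pow, hm.natDegree_pow] at hlt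
    have htk : t < k := by
      by_contra hc
      have := Nat.mul_le_mul_right f.natDegree (not_lt.1 hc)
      omega
    refine ⟨t, G, Or.inr ⟨isUnit_ofPoly hf hG, exists_digits hm _ ?_⟩, fun _ => ⟨htk, hG⟩,
      h /ₘ f ^ k, ?_⟩
    · rw [Polynomial.degree_eq_natDegree hG0, Nat.cast_lt, mul_comm, Nat.sub_mul]
      omega
    · rw [e] at hdiv
      linear_combination -hdiv

/-- If `f^k` divides `f^i G` with `f ∤ G` then `k ≤ i`. -/
lemma le_of_pow_dvd_pow_mul (hf : Irreducible f) {k i : ℕ} {G : F[X]} (hG : ¬ f ∣ G)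
    (h : f ^ k ∣ f ^ i * G) : k ≤ i :=
  (pow_dvd_pow_iff hf.ne_zero hf.not_isUnit).1 (hf.prime.pow_dvd_of_dvd_mul_right k hG h)

end Digits

/-! ### The three types of ideals. -/

section Types

variable {F : Type*} [Field F] {f : F[X]} {q : ℕ} {I : Ideal (KRing f q)} {a b c : ℕ}

/-- A second generator `u f^b + u² f^θ V` with reduced `V`. -/
lemma HasExponents.exists_second (hm : f.Monic) (hf : Irreducible f) (h : HasExponents I a b c) :
    ∃ (θ : ℕ) (V : F[X]), IsZeroOrUnitPoly f q (c - θ) V ∧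
      (V ≠ 0 → b + c ≤ q + θ ∧ θ < c) ∧
      uElt f q * ofPoly f q (f ^ b) + uElt f q ^ 2 * ofPoly f q (f ^ θ * V) ∈ I := by
  have hu := uElt_pow_three (f := f) (q := q)
  obtain ⟨v, m₂⟩ := (h.tor (f ^ b)).2 dvd_rfl
  obtain ⟨θ, V, hV, hb, hd⟩ := exists_reduced (q := q) hm hf c v
  have m₂' : uElt f q * ofPoly f q (f ^ b) + uElt f q ^ 2 * ofPoly f q (f ^ θ * V) ∈ I := by
    convert I.sub_mem m₂ ((h.tor2 _).2 hd) using 1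
    rw [map_sub]
    ring
  refine ⟨θ, V, hV, fun hV0 => ⟨?_, (hb hV0).1⟩, m₂'⟩
  -- Multiplication by `f^(q-b)` kills the `u` term; as `f ∤ V`, membership forces `c ≤ q - b + θ`.
  have m : uElt f q ^ 2 * ofPoly f q (f ^ (q - b + θ) * V) ∈ I := by
    convert I.mul_mem_left (ofPoly f q (f ^ (q - b))) m₂' using 1
    have e : ofPoly f q (f ^ (q - b)) * ofPoly f q (f ^ b) = 0 := by
      rw [← map_mul, pow_sub_mul_pow f (h.hba.trans h.haq)]
      exact ofPoly_eq_zero_of_dvd dvd_rfl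
    simp only [pow_add, map_mul] at e ⊢
    linear_combination -uElt f q * e
  have := le_of_pow_dvd_pow_mul hf (hb hV0).2 ((h.tor2 _).1 m)
  have := h.hba.trans h.haq
  omega

lemma HasExponents.exists_isTypeIII (hm : f.Monic) (hf : Irreducible f)
    (h : HasExponents I a b c) :
    ∃ (t₁ t₂ θ : ℕ) (D₁ D₂ V : F[X]), IsTypeIII I a b c t₁ t₂ θ D₁ D₂ V := by
  obtain ⟨θ, V, hV, hVb, m₂⟩ := h.exists_second hm hf
  obtain ⟨h₁, h₂, m₁⟩ := (h.res (f ^ a)).2 dvd_rfl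
  obtain ⟨t₁, D₁, hD₁, hb₁, x, hx⟩ := exists_reduced (q := q) hm hf b h₁
  -- Reducing `h₁` modulo `f^b` subtracts `x` times the second generator, which alters the `u²`
  -- coefficient before it is reduced.
  obtain ⟨t₂, D₂, hD₂, hb₂, hd₂⟩ := exists_reduced (q := q) hm hf c (h₂ - x * (f ^ θ * V))
  have m₁' : ofPoly f q (f ^ a) + uElt f q * ofPoly f q (f ^ t₁ * D₁)
      + uElt f q ^ 2 * ofPoly f q (f ^ t₂ * D₂) ∈ I := by
    convert I.sub_mem (I.sub_mem m₁ (I.mul_mem_left (ofPoly f q x) m₂))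
      ((h.tor2 _).2 hd₂) using 1
    have e := congrArg (ofPoly f q) hx
    simp only [map_sub, map_mul] at e ⊢
    linear_combination -uElt f q * e
  refine ⟨t₁, t₂, θ, D₁, D₂, V, hD₁, hD₂, hV, fun hD0 => ⟨?_, (hb₁ hD0).1⟩,
    fun hD0 => (hb₂ hD0).1, hVb, h.eq_span hm m₁' m₂⟩
  -- Likewise `f^(q-a)` kills the leading term, so `b ≤ q - a + t₁`.
  have m : uElt f q * ofPoly f q (f ^ (q - a + t₁) * D₁)
      + uElt f q ^ 2 * ofPoly f q (f ^ (q - a) * (f ^ t₂ * D₂)) ∈ I := by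
    convert I.mul_mem_left (ofPoly f q (f ^ (q - a))) m₁' using 1
    have e : ofPoly f q (f ^ (q - a)) * ofPoly f q (f ^ a) = 0 := by
      rw [← map_mul, pow_sub_mul_pow f h.haq]
      exact ofPoly_eq_zero_of_dvd dvd_rfl
    simp only [pow_add, map_mul] at e ⊢
    linear_combination -e
  have := le_of_pow_dvd_pow_mul hf (hb₁ hD0).2 ((h.tor _).1 ⟨_, m⟩)
  have := h.haq
  omega

lemma ofPoly_self_pow : ofPoly f q (f ^ q) = 0 := ofPoly_eq_zero_of_dvd dvd_rfl

lemma HasExponents.exists_isTypeII (hm : f.Monic) (hf : Irreducible f)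
    (h : HasExponents I q b c) : ∃ (t : ℕ) (G : F[X]), IsTypeII I b c t G := by
  obtain ⟨t, G, hG, hb, m₂⟩ := h.exists_second hm hf
  refine ⟨t, G, hG, fun h0 => ⟨by have := (hb h0).1; omega, (hb h0).2⟩, ?_⟩
  have := h.eq_span hm (h₁ := 0) (h₂ := 0) (by simp [ofPoly_self_pow]) m₂
  simpa [ofPoly_self_pow] using this

lemma HasExponents.eq_span_of_eq (hm : f.Monic) (h : HasExponents I q q c) :
    I = Ideal.span {uElt f q ^ 2 * ofPoly f q (f ^ c)} := by
  have := h.eq_span hm (h₁ := 0) (h₂ := 0) (v := 0) (by simp [ofPoly_self_pow])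
    (by simp [ofPoly_self_pow])
  simpa [ofPoly_self_pow] using this

/-- Here `q - a = q - b = 0`, so the last two generators become `u` and `u²`, and `u²` is redundant.
-/
lemma HasExponents.annihilator_of_eq (hm : f.Monic) (h : HasExponents I q q c) :
    Submodule.annihilator I = Ideal.span {ofPoly f q (f ^ (q - c)), uElt f q} := by
  have := h.annihilator_eq hm.ne_zero (h₁ := 0) (h₂ := 0) (v := 0) (w₁ := 0) (w₂ := 0) (A := 0)
    (by simpa [ofPoly_self_pow] using h.eq_span_of_eq hm) (by simp) (by simp) (by simp)
  rw [this]
  simp only [Nat.sub_self, pow_zero, map_one, map_zero, mul_zero, sub_zero, add_zero, mul_one]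
  refine le_antisymm (Ideal.span_le.2 ?_) (Ideal.span_mono ?_)
  · rintro _ (rfl | rfl | rfl)
    · exact Ideal.subset_span (by simp)
    · exact Ideal.subset_span (by simp)
    · rw [pow_two]
      exact Ideal.mul_mem_left _ _ (Ideal.subset_span (by simp))
  · rintro _ (rfl | rfl) <;> simp

lemma IsTypeII.annihilator_eq (hm : f.Monic) (h : HasExponents I q b c) {t : ℕ} {G : F[X]}
    (hI : IsTypeII I b c t G) :
    Submodule.annihilator I = Ideal.span
      {ofPoly f q (f ^ (q - c)) - uElt f q * ofPoly f q (f ^ (q + t - (b + c)) * G),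
       uElt f q * ofPoly f q (f ^ (q - b)), uElt f q ^ 2} := by
  have hbq := h.hba
  have hcb := h.hcb
  have := h.annihilator_eq hm.ne_zero (h₁ := 0) (h₂ := 0) (v := f ^ t * G)
    (w₁ := f ^ (q + t - (b + c)) * G) (w₂ := 0) (A := 0)
    (by simpa [ofPoly_self_pow] using hI.eq_span)
    (by
      -- The truncated exponent `q + t - (b + c)` is a true difference once `G ≠ 0`.
      by_cases hG : G = 0
      · simp [hG]
      · have := hI.bound_t hG
        rw [← mul_assoc, ← mul_assoc, ← pow_add, ← pow_add]
        congr 2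
        omega) (by simp) (by simp)
  simpa using this

/-- Take `f^(q+t₁-(a+b)) D₁` times the second generator minus `f^(q-a)` times the first. The terms
in `1` and `u` cancel, so what remains is in `I ∩ u²𝒦`, and its coefficient is divisible by `f^c`.
-/
lemma IsTypeIII.exists_isQuotientA (h : HasExponents I a b c) {t₁ t₂ θ : ℕ} {D₁ D₂ V : F[X]}
    (hI : IsTypeIII I a b c t₁ t₂ θ D₁ D₂ V) :
    ∃ A : ResRing f q, IsQuotientA a b c t₁ t₂ θ D₁ D₂ V A := by
  have haq := h.haq
  have hba := h.hba
  have m₁ : ofPoly f q (f ^ a) + uElt f q * ofPoly f q (f ^ t₁ * D₁)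
      + uElt f q ^ 2 * ofPoly f q (f ^ t₂ * D₂) ∈ I := by
    rw [hI.eq_span]; exact Ideal.subset_span (by simp)
  have m₂ : uElt f q * ofPoly f q (f ^ b) + uElt f q ^ 2 * ofPoly f q (f ^ θ * V) ∈ I := by
    rw [hI.eq_span]; exact Ideal.subset_span (by simp)
  have key : uElt f q ^ 2 * ofPoly f q
      (f ^ (q + t₁ + θ - (a + b)) * V * D₁ - f ^ (q + t₂ - a) * D₂) ∈ I := by
    convert I.sub_mem (I.mul_mem_left (ofPoly f q (f ^ (q + t₁ - (a + b)) * D₁)) m₂)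
      (I.mul_mem_left (ofPoly f q (f ^ (q - a))) m₁) using 1
    have e₀ : ofPoly f q (f ^ (q - a)) * ofPoly f q (f ^ a) = 0 := by
      rw [← map_mul, pow_sub_mul_pow f haq, ofPoly_self_pow]
    have e₁ : f ^ (q + t₁ - (a + b)) * D₁ * f ^ b = f ^ (q - a) * (f ^ t₁ * D₁) := by
      by_cases hD : D₁ = 0
      · simp [hD]
      · have := (hI.bound_t₁ hD).1
        rw [mul_right_comm, ← mul_assoc, ← pow_add, ← pow_add]
        congr 2
        omega
    have e₂ : f ^ (q + t₁ + θ - (a + b)) * V * D₁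
        = f ^ (q + t₁ - (a + b)) * D₁ * (f ^ θ * V) := by
      by_cases hD : D₁ = 0
      · simp [hD]
      · have := (hI.bound_t₁ hD).1
        rw [show q + t₁ + θ - (a + b) = q + t₁ - (a + b) + θ by omega, pow_add]
        ring
    have e₃ : f ^ (q + t₂ - a) * D₂ = f ^ (q - a) * (f ^ t₂ * D₂) := by
      rw [show q + t₂ - a = q - a + t₂ by omega, pow_add, mul_assoc]
    replace e₁ := congrArg (ofPoly f q) e₁
    rw [e₂, e₃, map_sub]
    simp only [map_mul] at e₁ ⊢
    linear_combination e₀ - uElt f q * e₁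
  obtain ⟨y, hy⟩ := (h.tor2 _).1 key
  refine ⟨AdjoinRoot.mk _ y, ?_⟩
  rw [IsQuotientA, hy, ofRes_mk, map_mul, mul_assoc]

lemma IsTypeIII.annihilator_eq (hm : f.Monic) (h : HasExponents I a b c) {t₁ t₂ θ : ℕ}
    {D₁ D₂ V : F[X]} (hI : IsTypeIII I a b c t₁ t₂ θ D₁ D₂ V) {A : ResRing f q}
    (hA : IsQuotientA a b c t₁ t₂ θ D₁ D₂ V A) :
    Submodule.annihilator I = Ideal.span
      {ofPoly f q (f ^ (q - c)) - uElt f q * ofPoly f q (f ^ (q + θ - (b + c)) * V)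
          + uElt f q ^ 2 * ofRes f q A,
       uElt f q * ofPoly f q (f ^ (q - b))
          - uElt f q ^ 2 * ofPoly f q (f ^ (q + t₁ - (a + b)) * D₁),
       uElt f q ^ 2 * ofPoly f q (f ^ (q - a))} := by
  have haq := h.haq
  have hba := h.hba
  have hcb := h.hcb
  obtain ⟨A, rfl⟩ := AdjoinRoot.mk_surjective A
  rw [ofRes_mk]
  refine h.annihilator_eq hm.ne_zero hI.eq_span ?_ ?_ ?_
  · by_cases hV : V = 0
    · simp [hV]
    · have := (hI.bound_θ hV).1
      rw [← mul_assoc, ← mul_assoc, ← pow_add, ← pow_add]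
      congr 2
      omega
  · by_cases hD : D₁ = 0
    · simp [hD]
    · have := (hI.bound_t₁ hD).1
      rw [← mul_assoc, ← mul_assoc, ← pow_add, ← pow_add]
      congr 2
      omega
  · rw [IsQuotientA, ofRes_mk] at hA
    obtain ⟨-, -, y, hy⟩ := dvd_of_sum_eq_zero (f := f) (q := q) (g₀ := 0) (g₁ := 0)
      (g₂ := f ^ (q + t₁ + θ - (a + b)) * V * D₁ - f ^ (q + t₂ - a) * D₂ - f ^ c * A) (by
        rw [map_sub _ _ (f ^ c * A), map_mul _ (f ^ c), map_zero]
        linear_combination hA)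
    -- Multiplying the relation defining `A` by `-f^(a-c)` gives the required congruence modulo
    -- `f^q`.
    have e₁ : f ^ (a - c) * (f ^ (q + t₁ + θ - (a + b)) * V * D₁)
        = f ^ (q + θ - (b + c)) * V * (f ^ t₁ * D₁) := by
      by_cases hV : V = 0
      · simp [hV]
      by_cases hD : D₁ = 0
      · simp [hD]
      have h₁ := (hI.bound_t₁ hD).1
      have h₂ := (hI.bound_θ hV).1
      have e : f ^ (a - c) * f ^ (q + t₁ + θ - (a + b)) = f ^ (q + θ - (b + c)) * f ^ t₁ := by
        rw [← pow_add, ← pow_add]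
        congr 1
        omega
      linear_combination V * D₁ * e
    have e₂ : f ^ (a - c) * f ^ (q + t₂ - a) = f ^ (q - c) * f ^ t₂ := by
      rw [← pow_add, ← pow_add]
      congr 1
      omega
    have e₃ := pow_sub_mul_pow f (hcb.trans hba)
    refine ⟨-f ^ (a - c) * y, ?_⟩
    linear_combination -f ^ (a - c) * hy + e₁ - D₂ * e₂ - A * e₃

end Types

end Constacyclic

open Constacyclic in
theorem mainTheorem2
    (p n s m : ℕ) (hp : p.Prime) (hn : 0 < n) (hs : 0 < s) (hm : 0 < m)
    (hnp : Nat.Coprime n p)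
    {F : Type*} [Field F] [Finite F] (hF : Nat.card F = p ^ m)
    (α α₀ : F) (hα : α ≠ 0) (hα₀ : α₀ ^ p ^ s = α)
    (r : ℕ) (f : Fin r → F[X])
    (hmonic : ∀ i, (f i).Monic) (hirr : ∀ i, Irreducible (f i))
    (hcop : Pairwise fun i k => IsCoprime (f i) (f k))
    (hprod : Polynomial.X ^ n - Polynomial.C α₀ = ∏ i, f i)
    (j : Fin r)
    (I : Ideal (KRing (f j) (p ^ s))) (hbot : I ≠ ⊥) (htop : I ≠ ⊤) :
    (∃ a b c : ℕ, c ≤ b ∧ b ≤ a ∧ a ≤ p ^ s ∧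
      ResU I = Ideal.span {AdjoinRoot.mk _ (f j ^ a)} ∧
      TorU I = Ideal.span {AdjoinRoot.mk _ (f j ^ b)} ∧
      TorU2 I = Ideal.span {AdjoinRoot.mk _ (f j ^ c)}) ∧
    ∀ a b c : ℕ, c ≤ b → b ≤ a → a ≤ p ^ s →
      ResU I = Ideal.span {AdjoinRoot.mk _ (f j ^ a)} →
      TorU I = Ideal.span {AdjoinRoot.mk _ (f j ^ b)} →
      TorU2 I = Ideal.span {AdjoinRoot.mk _ (f j ^ c)} →
    -- Type I
    (a = p ^ s → b = p ^ s →
      c < p ^ s ∧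
      I = Ideal.span {uElt (f j) (p ^ s) ^ 2 * ofPoly (f j) (p ^ s) (f j ^ c)} ∧
      Nat.card I = p ^ (m * (f j).natDegree * (p ^ s - c)) ∧
      Submodule.annihilator I =
        Ideal.span {ofPoly (f j) (p ^ s) (f j ^ (p ^ s - c)), uElt (f j) (p ^ s)}) ∧
    -- Type II
    (a = p ^ s → b < p ^ s →
      (∃ (t : ℕ) (G : F[X]), IsTypeII I b c t G) ∧
      Nat.card I = p ^ (m * (f j).natDegree * (2 * p ^ s - b - c)) ∧
      ∀ (t : ℕ) (G : F[X]), IsTypeII I b c t G →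
        Submodule.annihilator I = Ideal.span
          {ofPoly (f j) (p ^ s) (f j ^ (p ^ s - c))
              - uElt (f j) (p ^ s) * ofPoly (f j) (p ^ s) (f j ^ (p ^ s + t - (b + c)) * G),
           uElt (f j) (p ^ s) * ofPoly (f j) (p ^ s) (f j ^ (p ^ s - b)),
           uElt (f j) (p ^ s) ^ 2}) ∧
    -- Type III
    (a < p ^ s →
      (∃ (t₁ t₂ θ : ℕ) (D₁ D₂ V : F[X]), IsTypeIII I a b c t₁ t₂ θ D₁ D₂ V) ∧
      Nat.card I = p ^ (m * (f j).natDegree * (3 * p ^ s - a - b - c)) ∧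
      ∀ (t₁ t₂ θ : ℕ) (D₁ D₂ V : F[X]), IsTypeIII I a b c t₁ t₂ θ D₁ D₂ V →
        (∃ A : ResRing (f j) (p ^ s), IsQuotientA a b c t₁ t₂ θ D₁ D₂ V A) ∧
        ∀ A : ResRing (f j) (p ^ s), IsQuotientA a b c t₁ t₂ θ D₁ D₂ V A →
          Submodule.annihilator I = Ideal.span
            {ofPoly (f j) (p ^ s) (f j ^ (p ^ s - c))
                - uElt (f j) (p ^ s) * ofPoly (f j) (p ^ s) (f j ^ (p ^ s + θ - (b + c)) * V)
                + uElt (f j) (p ^ s) ^ 2 * ofRes (f j) (p ^ s) A,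
             uElt (f j) (p ^ s) * ofPoly (f j) (p ^ s) (f j ^ (p ^ s - b))
                - uElt (f j) (p ^ s) ^ 2
                  * ofPoly (f j) (p ^ s) (f j ^ (p ^ s + t₁ - (a + b)) * D₁),
             uElt (f j) (p ^ s) ^ 2 * ofPoly (f j) (p ^ s) (f j ^ (p ^ s - a))}) := by
  have hf := hirr j
  have hm := hmonic j
  refine ⟨exists_exponents hf I, fun a b c hcb hba haq hr ht ht2 => ?_⟩
  have h := HasExponents.of_eq hcb hba haq hr ht ht2
  have hcard := h.natCard_eq hm
  rw [hF, ← pow_mul, ← mul_assoc] at hcard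
  refine ⟨?_, ?_, fun _ => ⟨h.exists_isTypeIII hm hf, hcard, fun t₁ t₂ θ D₁ D₂ V hI =>
    ⟨hI.exists_isQuotientA h, fun A hA => hI.annihilator_eq hm h hA⟩⟩⟩
  · rintro rfl rfl
    refine ⟨lt_of_le_of_ne hcb ?_, h.eq_span_of_eq hm, ?_, h.annihilator_of_eq hm⟩
    -- If `c = q`, the generator `u² f^q` is zero, contrary to `I ≠ ⊥`.
    · rintro rfl
      exact hbot (by simpa [ofPoly_self_pow] using h.eq_span_of_eq hm)
    · rw [hcard]
      congr 2
      omega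
  · rintro rfl -
    refine ⟨h.exists_isTypeII hm hf, ?_, fun t G hI => hI.annihilator_eq hm h⟩
    rw [hcard]
    congr 2
    omega
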